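/- Let $n\ge 1$, $d\ge 0$ be integers and $k>0$ real. Consider the following two-person zero-sum game (the Multiple Caching Game with real $k$). The hider distributes $d$ indistinguishable treasures among $n$ boxes (several treasures may be put in one box), possibly at random. Then there are $d$ steps. In each step the searcher queries a random set $Q$ of boxes; its distribution may depend on all earlier queries and revealed boxes, and, given any such history, the expected number of boxes $\mathbb E|Q|$ must equal $k$. If no box of $Q$ contains a treasure, the searcher loses. Otherwise the hider chooses (possibly at random, knowing the history, $Q$ and the allocation) a box of $Q$ that contains a treasure, and one treasure of that box is revealed to the searcher and removed. The searcher wins if she finds all $d$ treasures. The value of the game is the number $v$ such that the searcher has a strategy which wins with probability at least $v$ against every strategy of the hider, and the hider has a strategy against which every strategy of the searcher wins with probability at most $v$. **Theorem.** For every integer $d\ge 0$ and every real $k>0$ there is an $N$ such that for all $n\ge N$ the value of this game exists and equals $$\frac{k^d}{\binom{n+d-1}{d}}.$$ -/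

import Mathlib

/-! The Multiple Caching Game with `n` boxes, `d` treasures and a real query size `k`. -/

noncomputable section

namespace CachingGame

/-- What both players have seen so far: for every past step the queried set of boxes and the box
from which the hider revealed and removed a treasure. The most recent step comes first. -/
abbrev History (n : ℕ) : Type := List (Finset (Fin n) × Fin n)

/-- The ways to distribute `d` (indistinguishable) treasures among `n` boxes, several treasures
per box being allowed: multisets of boxes of size `d`. -/
abbrev Allocation (n d : ℕ) : Type := Sym (Fin n) d

/-- The treasures that are still hidden after the history `h`, if they were allocated by `a`. -/
def remaining {n d : ℕ} (a : Allocation n d) (h : History n) : Multiset (Fin n) :=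
  (a : Multiset (Fin n)) - (h.map Prod.snd : Multiset (Fin n))

/-- The queried boxes that still contain a treasure. -/
def available {n d : ℕ} (a : Allocation n d) (h : History n) (Q : Finset (Fin n)) :
    Finset (Fin n) :=
  Q.filter (fun j => j ∈ remaining a h)

/-- A (randomized) strategy of the searcher: after every history, a probability for each possible
query (any set of boxes), such that the expected number of queried boxes in this step is `k`. -/
structure SearchStrategy (n : ℕ) (k : ℝ) where
  prob : History n → Finset (Fin n) → ℝ
  prob_nonneg : ∀ h Q, 0 ≤ prob h Q
  prob_sum : ∀ h, ∑ Q : Finset (Fin n), prob h Q = 1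
  expected_size : ∀ h, ∑ Q : Finset (Fin n), prob h Q * (Q.card : ℝ) = k

/-- A (randomized) strategy of the hider: a probability for each allocation of the treasures, and,
for each allocation, history and query which hits at least one nonempty box, a probability
distribution on the nonempty queried boxes, from which the box of the revealed treasure is drawn. -/
structure HideStrategy (n d : ℕ) where
  hide : Allocation n d → ℝ
  hide_nonneg : ∀ a, 0 ≤ hide a
  hide_sum : ∑ a : Allocation n d, hide a = 1
  reveal : Allocation n d → History n → Finset (Fin n) → Fin n → ℝ
  reveal_nonneg : ∀ a h Q j, 0 ≤ reveal a h Q j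
  reveal_support : ∀ a h Q j, j ∉ available a h Q → reveal a h Q j = 0
  reveal_sum : ∀ a h Q, (available a h Q).Nonempty → ∑ j ∈ available a h Q, reveal a h Q j = 1

/-- The probability that the searcher finds a treasure in each of the next `m` steps, if the
allocation is `a` and the history so far is `h`. A query that hits no treasure loses: it
contributes an empty sum. -/
def winProbFrom {n d : ℕ} {k : ℝ} (σ : SearchStrategy n k) (τ : HideStrategy n d)
    (a : Allocation n d) : ℕ → History n → ℝ
  | 0, _ => 1
  | m + 1, h => ∑ Q : Finset (Fin n), σ.prob h Q *
      ∑ j ∈ available a h Q, τ.reveal a h Q j * winProbFrom σ τ a m ((Q, j) :: h)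

/-- The probability that the searcher wins, i.e. finds all `d` treasures. -/
def winProb {n d : ℕ} {k : ℝ} (σ : SearchStrategy n k) (τ : HideStrategy n d) : ℝ :=
  ∑ a : Allocation n d, τ.hide a * winProbFrom σ τ a d []

/-- `v` is the value of the two-person zero-sum game with the given payoff to the first player:
the first player has a strategy that secures at least `v` against every strategy of the second,
and the second player has a strategy that concedes at most `v` to every strategy of the first. -/
def IsValue {S T : Type*} (payoff : S → T → ℝ) (v : ℝ) : Prop :=
  (∃ s, ∀ t, v ≤ payoff s t) ∧ (∃ t, ∀ s, payoff s t ≤ v)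

end CachingGame

end

/-!
The number of allocations is `(n + d - 1).choose d`, so the claim is that the best both players can
do is `k ^ d / #allocations`.

*The hider* allocates uniformly at random and reveals boxes in any way. The sequence of revealed
boxes of a won game determines the allocation, so the winning probabilities of a search strategy,
summed over all allocations, are at most the expected number of sequences of boxes taken from
successive queries. Each step contributes a factor `𝔼|Q| = k`, whence the bound `k ^ d`
(`sum_winProbFrom_le`).

*The searcher* needs a strategy that loses nothing in this estimate and treats all allocations
alike. Let `K = ⌈k⌉`. A search tree (`TreeData`) prescribes a query of `K` boxes after each sequence
of revealed boxes, such that the boxes of a query that were not revealed are never queried again.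
The tree has `K ^ d` leaves, which are different allocations; against each of them every query
contains only one nonempty box, so that the hider has no choice (`IsForced`). Making each query with
probability `k / K` only, and the empty query otherwise, gives a strategy with expected query size
`k` that wins with probability `(k / K) ^ d` against each leaf (`TreeData.exists_strategy`).

It remains to mix such trees so that all allocations are leaves equally often; mixtures are realized
by behavioural strategies (`exists_mixture`). By a random renaming of the boxes only the shape of
an allocation, i.e. its orbit under renaming, matters (`card_ofShape_mul_card_renamingsOnto`). Each
shape is a leaf of a tree all of whose leaves of other shapes have more occupied boxes
(`exists_treeData`): one branch of the tree follows a list of the treasures that ends with a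
repetition, and all other branches switch to fresh boxes. (If no box holds two treasures, all
leaves have the same shape.) So the weights of the trees solve a triangular system. For large `n`
each shape has many more allocations than all shapes with fewer occupied boxes together
(`mul_card_occupied_lt_le_card_ofShape`), and this makes the weights nonnegative
(`exists_nonneg_solution`).
-/

namespace CachingGame

variable {n d : ℕ} {k : ℝ}

/-! ### The bound for the hider -/

theorem HideStrategy.reveal_le_one (τ : HideStrategy n d) {a : Allocation n d} {h : History n}
    {Q : Finset (Fin n)} {j : Fin n} (hj : j ∈ available a h Q) : τ.reveal a h Q j ≤ 1 := by
  rw [← τ.reveal_sum a h Q ⟨j, hj⟩]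
  exact Finset.single_le_sum (fun i _ => τ.reveal_nonneg a h Q i) hj

theorem winProbFrom_nonneg (σ : SearchStrategy n k) (τ : HideStrategy n d) (a : Allocation n d)
    (m : ℕ) (h : History n) : 0 ≤ winProbFrom σ τ a m h := by
  induction m generalizing h with
  | zero => simp [winProbFrom]
  | succ m ih =>
    rw [winProbFrom]
    exact Finset.sum_nonneg fun Q _ => mul_nonneg (σ.prob_nonneg h Q) <|
      Finset.sum_nonneg fun j _ => mul_nonneg (τ.reveal_nonneg a h Q j) (ih _)

theorem cons_le_iff_mem_remaining (a : Allocation n d) (h : History n) (Q : Finset (Fin n))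
    (j : Fin n) :
    ((((Q, j) :: h).map Prod.snd : List (Fin n)) : Multiset (Fin n)) ≤ a ↔
      ((h.map Prod.snd : List (Fin n)) : Multiset (Fin n)) ≤ a ∧ j ∈ remaining a h := by
  rw [remaining, List.map_cons, ← Multiset.cons_coe, ← Multiset.singleton_add]
  constructor
  · intro H
    refine ⟨(Multiset.le_add_left _ _).trans H, Multiset.singleton_le.1 ?_⟩
    have := tsub_le_tsub_right H ((h.map Prod.snd : List (Fin n)) : Multiset (Fin n))
    rwa [add_tsub_cancel_right] at this
  · rintro ⟨h1, h2⟩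
    rw [← Multiset.singleton_le] at h2
    have := add_le_add_left h2 ((h.map Prod.snd : List (Fin n)) : Multiset (Fin n))
    rwa [tsub_add_cancel_of_le h1] at this

/-- The allocations under which all boxes revealed in the history contain enough treasures. -/
def compatible (d : ℕ) (h : History n) : Finset (Allocation n d) :=
  Finset.univ.filter fun a : Allocation n d =>
    ((h.map Prod.snd : List (Fin n)) : Multiset (Fin n)) ≤ (a : Multiset (Fin n))

/-- A winning transcript determines the allocation, so the winning probabilities, summed over all
allocations that are compatible with the history, are at most the expected number of transcripts,
whatever the hider reveals. -/
theorem sum_winProbFrom_le (σ : SearchStrategy n k) (τ : HideStrategy n d) (m : ℕ)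
    (h : History n) (hm : h.length + m = d) :
    ∑ a ∈ compatible d h, winProbFrom σ τ a m h ≤ k ^ m := by
  induction m generalizing h with
  | zero =>
    simp only [winProbFrom, Finset.sum_const, nsmul_eq_mul, mul_one, pow_zero]
    norm_cast
    refine Finset.card_le_one.2 fun a ha b hb => ?_
    simp only [compatible, Finset.mem_filter, Finset.mem_univ, true_and] at ha hb
    have ha' := Multiset.eq_of_le_of_card_le ha (by simp; omega)
    have hb' := Multiset.eq_of_le_of_card_le hb (by simp; omega)
    exact Subtype.ext (ha'.symm.trans hb')
  | succ m ih =>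
    calc ∑ a ∈ compatible d h, winProbFrom σ τ a (m + 1) h
        ≤ ∑ a ∈ compatible d h, ∑ Q, ∑ j ∈ Q, σ.prob h Q *
            if j ∈ remaining a h then winProbFrom σ τ a m ((Q, j) :: h) else 0 := by
          refine Finset.sum_le_sum fun a _ => ?_
          rw [winProbFrom]
          refine Finset.sum_le_sum fun Q _ => ?_
          rw [← Finset.mul_sum, ← Finset.sum_filter]
          refine mul_le_mul_of_nonneg_left ?_ (σ.prob_nonneg h Q)
          exact Finset.sum_le_sum fun j hj =>
            mul_le_of_le_one_left (winProbFrom_nonneg _ _ _ _ _) (τ.reveal_le_one hj)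
      _ = ∑ Q, σ.prob h Q * ∑ j ∈ Q, ∑ a ∈ compatible d ((Q, j) :: h),
              winProbFrom σ τ a m ((Q, j) :: h) := by
          rw [Finset.sum_comm]
          refine Finset.sum_congr rfl fun Q _ => ?_
          rw [Finset.sum_comm, Finset.mul_sum]
          refine Finset.sum_congr rfl fun j _ => ?_
          rw [← Finset.mul_sum, ← Finset.sum_filter, compatible, compatible,
            Finset.filter_filter]
          simp only [cons_le_iff_mem_remaining]
      _ ≤ ∑ Q, σ.prob h Q * ∑ j ∈ Q, k ^ m := by
          refine Finset.sum_le_sum fun Q _ => mul_le_mul_of_nonneg_left ?_ (σ.prob_nonneg h Q)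
          exact Finset.sum_le_sum fun j _ => ih _ (by simp; omega)
      _ = k ^ (m + 1) := by
          simp only [Finset.sum_const, nsmul_eq_mul, ← mul_assoc]
          rw [← Finset.sum_mul, σ.expected_size, pow_succ']

/-- The hider who allocates uniformly at random and reveals some available box. -/
noncomputable def uniformHider (n d : ℕ) [Nonempty (Allocation n d)] : HideStrategy n d where
  hide _ := 1 / Fintype.card (Allocation n d)
  hide_nonneg _ := by positivity
  hide_sum := by simp
  reveal a h Q j := by
    classical exact if H : (available a h Q).Nonempty then (if j = H.choose then 1 else 0) else 0
  reveal_nonneg a h Q j := by split_ifs <;> norm_num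
  reveal_support a h Q j hj := by
    split_ifs with H1 H2
    · exact absurd (H2 ▸ H1.choose_spec) hj
    · rfl
    · rfl
  reveal_sum a h Q H := by simp [H, H.choose_spec]

theorem winProb_uniformHider_le [Nonempty (Allocation n d)]
    (σ : SearchStrategy n k) :
    winProb σ (uniformHider n d) ≤ k ^ d / Fintype.card (Allocation n d) := by
  have := sum_winProbFrom_le σ (uniformHider n d) d [] (by simp)
  simp only [compatible, List.map_nil, Multiset.coe_nil, Multiset.zero_le,
    Finset.filter_true] at this
  rw [winProb]
  simp only [uniformHider, one_div_mul_eq_div] at this ⊢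
  rw [← Finset.sum_div]
  gcongr

/-! ### Mixtures of search strategies -/

/-- The weight of the strategy `σ`, initially `p`, after it has produced the queries of the
history. -/
def posteriorWeight (p : ℝ) (σ : SearchStrategy n k) : History n → ℝ
  | [] => p
  | x :: h => posteriorWeight p σ h * σ.prob h x.1

theorem posteriorWeight_nonneg {p : ℝ} (hp : 0 ≤ p) (σ : SearchStrategy n k) (h : History n) :
    0 ≤ posteriorWeight p σ h := by
  induction h with
  | nil => exact hp
  | cons x h ih => exact mul_nonneg ih (σ.prob_nonneg h x.1)

/-- The behaviour of a searcher who draws one of the strategies `σ i` with probabilities `p i` at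
the beginning. After a history that has probability zero the strategy `σ i₀` is followed. -/
noncomputable def mixture {ι : Type*} [Fintype ι] (p : ι → ℝ) (hp : ∀ i, 0 ≤ p i)
    (σ : ι → SearchStrategy n k) (i₀ : ι) : SearchStrategy n k where
  prob h Q := if ∑ i, posteriorWeight (p i) (σ i) h = 0 then (σ i₀).prob h Q else
    (∑ i, posteriorWeight (p i) (σ i) h * (σ i).prob h Q) / ∑ i, posteriorWeight (p i) (σ i) h
  prob_nonneg h Q := by
    split_ifs
    · exact (σ i₀).prob_nonneg h Q
    · exact div_nonneg (Finset.sum_nonneg fun i _ =>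
        mul_nonneg (posteriorWeight_nonneg (hp i) _ _) ((σ i).prob_nonneg h Q))
        (Finset.sum_nonneg fun i _ => posteriorWeight_nonneg (hp i) _ _)
  prob_sum h := by
    split_ifs with H
    · exact (σ i₀).prob_sum h
    · rw [← Finset.sum_div, Finset.sum_comm]
      simp_rw [← Finset.mul_sum, (σ _).prob_sum, mul_one]
      exact div_self H
  expected_size h := by
    split_ifs with H
    · exact (σ i₀).expected_size h
    · simp_rw [div_mul_eq_mul_div, Finset.sum_mul]
      rw [← Finset.sum_div, Finset.sum_comm]
      simp_rw [mul_assoc, ← Finset.mul_sum, (σ _).expected_size]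
      rw [← Finset.sum_mul, mul_div_cancel_left₀ _ H]

theorem winProbFrom_mixture {ι : Type*} [Fintype ι] (p : ι → ℝ) (hp : ∀ i, 0 ≤ p i)
    (σ : ι → SearchStrategy n k) (i₀ : ι) (τ : HideStrategy n d) (a : Allocation n d) (m : ℕ)
    (h : History n) :
    (∑ i, posteriorWeight (p i) (σ i) h) * winProbFrom (mixture p hp σ i₀) τ a m h =
      ∑ i, posteriorWeight (p i) (σ i) h * winProbFrom (σ i) τ a m h := by
  induction m generalizing h with
  | zero => simp [winProbFrom]
  | succ m ih =>
    by_cases H : ∑ i, posteriorWeight (p i) (σ i) h = 0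
    · have H' := (Finset.sum_eq_zero_iff_of_nonneg
        fun i _ => posteriorWeight_nonneg (hp i) (σ i) h).1 H
      rw [H, zero_mul, Finset.sum_eq_zero fun i hi => by rw [H' i hi, zero_mul]]
    · have key : ∀ Q : Finset (Fin n), ∀ j : Fin n,
          (∑ i, posteriorWeight (p i) (σ i) h) * (mixture p hp σ i₀).prob h Q =
            ∑ i, posteriorWeight (p i) (σ i) ((Q, j) :: h) := by
        intro Q j
        simp only [mixture, if_neg H, posteriorWeight]
        field_simp
      simp only [winProbFrom, Finset.mul_sum]
      rw [Finset.sum_comm]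
      refine Finset.sum_congr rfl fun Q _ => ?_
      rw [Finset.sum_comm]
      refine Finset.sum_congr rfl fun j _ => ?_
      have := ih ((Q, j) :: h)
      rw [← key Q j] at this
      calc _ = τ.reveal a h Q j * ((∑ i, posteriorWeight (p i) (σ i) h) *
            (mixture p hp σ i₀).prob h Q *
              winProbFrom (mixture p hp σ i₀) τ a m ((Q, j) :: h)) := by ring
        _ = _ := by
          rw [this, Finset.mul_sum]
          refine Finset.sum_congr rfl fun i _ => ?_
          rw [posteriorWeight]
          ring

/-- Every mixed strategy of the searcher is equivalent to a behavioural one. -/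
theorem exists_mixture {ι : Type*} [Fintype ι] (p : ι → ℝ) (hp : ∀ i, 0 ≤ p i)
    (hp1 : ∑ i, p i = 1) (σ : ι → SearchStrategy n k) :
    ∃ σ' : SearchStrategy n k, ∀ (τ : HideStrategy n d) (a : Allocation n d),
      winProbFrom σ' τ a d [] = ∑ i, p i * winProbFrom (σ i) τ a d [] := by
  have : Nonempty ι := by
    by_contra H
    rw [not_nonempty_iff] at H
    simp at hp1
  obtain ⟨i₀⟩ := this
  refine ⟨mixture p hp σ i₀, fun τ a => ?_⟩
  simpa [posteriorWeight, hp1] using winProbFrom_mixture p hp σ i₀ τ a d []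

/-! ### Querying a set that depends on the revealed boxes -/

/-- The strategy that queries, after the boxes `l` have been revealed (the last one first), the set
`s l` of `K` boxes with probability `k / K`, and no box otherwise. -/
noncomputable def plannedSearch {K : ℕ} (hk : 0 < k) (hK : k ≤ K)
    (s : List (Fin n) → Finset (Fin n)) (hs : ∀ l, (s l).card = K) : SearchStrategy n k where
  prob h Q := (if Q = s (h.map Prod.snd) then k / K else 0) + if Q = ∅ then 1 - k / K else 0
  prob_nonneg h Q := by
    have : k / K ≤ 1 := div_le_one_of_le₀ hK (by positivity)
    have : 0 ≤ k / K := by positivity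
    split_ifs <;> linarith
  prob_sum h := by simp [Finset.sum_add_distrib]
  expected_size h := by
    have : (K : ℝ) ≠ 0 := (hk.trans_le hK).ne'
    simp [add_mul, Finset.sum_add_distrib, ite_mul, hs, this]

/-- `IsForced s l l'` says that a searcher who queries `s l` after the boxes `l` have been revealed
is shown the boxes `l'`, in this order, if these are the boxes of the remaining treasures: each
query contains, up to repetition, exactly one of the boxes that still hold a treasure. -/
def IsForced (s : List (Fin n) → Finset (Fin n)) : List (Fin n) → List (Fin n) → Prop
  | _, [] => True
  | l, j :: l' => j ∈ s l ∧ (∀ x ∈ l', x ∈ s l → x = j) ∧ IsForced s (j :: l) l'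

theorem IsForced.le_winProbFrom {K : ℕ} (hk : 0 < k) (hK : k ≤ K)
    {s : List (Fin n) → Finset (Fin n)} (hs : ∀ l, (s l).card = K) (τ : HideStrategy n d)
    (a : Allocation n d) (l' : List (Fin n)) (h : History n)
    (hf : IsForced s (h.map Prod.snd) l')
    (ha : (a : Multiset (Fin n)) = ((h.map Prod.snd : List (Fin n)) : Multiset (Fin n)) + l') :
    (k / K) ^ l'.length ≤ winProbFrom (plannedSearch hk hK s hs) τ a l'.length h := by
  induction l' generalizing h with
  | nil => simp [winProbFrom]
  | cons j l' ih =>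
    obtain ⟨hj, huniq, hf⟩ := hf
    have hK0 : 0 ≤ k / K := by positivity
    have hav : available a h (s (h.map Prod.snd)) = {j} := by
      ext x
      simp only [available, remaining, ha, add_tsub_cancel_left, Finset.mem_filter,
        Multiset.mem_coe, List.mem_cons, Finset.mem_singleton]
      constructor
      · rintro ⟨h1, rfl | h2⟩
        · rfl
        · exact huniq x h2 h1
      · rintro rfl
        exact ⟨hj, Or.inl rfl⟩
    have hrev : τ.reveal a h (s (h.map Prod.snd)) j = 1 := by
      have := τ.reveal_sum a h (s (h.map Prod.snd)) (by simp [hav])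
      simpa [hav] using this
    have hrec := ih ((s (h.map Prod.snd), j) :: h) (by simpa using hf) (by
      rw [ha, List.map_cons, ← Multiset.cons_coe, ← Multiset.cons_coe, Multiset.add_cons,
        Multiset.cons_add])
    rw [List.length_cons, winProbFrom]
    refine le_trans ?_ (Finset.single_le_sum (f := fun Q =>
      (plannedSearch hk hK s hs).prob h Q * ∑ j ∈ available a h Q, τ.reveal a h Q j *
        winProbFrom (plannedSearch hk hK s hs) τ a l'.length ((Q, j) :: h))
      (fun Q _ => mul_nonneg ((plannedSearch hk hK s hs).prob_nonneg h Q)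
        (Finset.sum_nonneg fun j _ => mul_nonneg (τ.reveal_nonneg a h Q j)
          (winProbFrom_nonneg _ _ _ _ _))) (Finset.mem_univ (s (h.map Prod.snd))))
    simp only [hav, Finset.sum_singleton, hrev, one_mul]
    rw [pow_succ']
    refine mul_le_mul ?_ hrec (by positivity) ((plannedSearch hk hK s hs).prob_nonneg _ _)
    have : k / K ≤ 1 := div_le_one_of_le₀ hK (by positivity)
    simp only [plannedSearch, if_true]
    split_ifs <;> linarith

/-! ### Search trees around a given word -/

/-- The data of a search tree with branching number `K` and `d` levels: a word `word 0, …` of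
boxes, and for every level `t < d` a block of `K` fresh boxes `fresh t i`, all fresh boxes being
different from each other and not in `support`, a set that contains the boxes of the word. Values
at levels `t ≥ d` are irrelevant. -/
structure TreeData (n d K : ℕ) where
  word : ℕ → Fin n
  support : Finset (Fin n)
  word_mem : ∀ t < d, word t ∈ support
  fresh : ℕ → Fin K → Fin n
  fresh_notMem : ∀ t < d, ∀ i, fresh t i ∉ support
  fresh_inj : ∀ t < d, ∀ t' < d, ∀ i i', fresh t i = fresh t' i' → t = t' ∧ i = i'

namespace TreeData

variable {K : ℕ} [NeZero K] (T : TreeData n d K)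

/-- The query at level `t = l.length`, if the boxes `l` have been revealed. As long as these are
boxes of the word, the next letter of the word takes the place of the fresh box with number `0`.
After the end of the game the query is `Q₀`. -/
def query (Q₀ : Finset (Fin n)) (l : List (Fin n)) : Finset (Fin n) :=
  if l.length < d then
    if ∀ x ∈ l, x ∈ T.support then
      insert (T.word l.length) ((Finset.univ.erase 0).image (T.fresh l.length))
    else Finset.univ.image (T.fresh l.length)
  else Q₀

/-- The box that is revealed at level `t`, if the treasures have been placed along the branch `χ`
of the tree: the word is followed until the first nonzero choice. -/
def path (χ : ℕ → Fin K) (t : ℕ) : Fin n :=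
  if ∀ s ≤ t, χ s = 0 then T.word t else T.fresh t (χ t)

variable {T}

theorem card_query {Q₀ : Finset (Fin n)} (hQ₀ : Q₀.card = K) (l : List (Fin n)) :
    (T.query Q₀ l).card = K := by
  have hK : 0 < K := Nat.pos_of_ne_zero (NeZero.ne K)
  unfold query
  split_ifs with h1 h2
  · have hinj : Function.Injective (T.fresh l.length) :=
      fun i i' h => (T.fresh_inj _ h1 _ h1 _ _ h).2
    rw [Finset.card_insert_of_notMem, Finset.card_image_of_injective _ hinj,
      Finset.card_erase_of_mem (Finset.mem_univ _), Finset.card_univ, Fintype.card_fin]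
    · omega
    · intro h
      obtain ⟨i, -, hi⟩ := Finset.mem_image.1 h
      exact T.fresh_notMem _ h1 i (hi ▸ T.word_mem _ h1)
  · have hinj : Function.Injective (T.fresh l.length) :=
      fun i i' h => (T.fresh_inj _ h1 _ h1 _ _ h).2
    rw [Finset.card_image_of_injective _ hinj, Finset.card_univ, Fintype.card_fin]
  · exact hQ₀

theorem path_mem_support_iff {χ : ℕ → Fin K} {t : ℕ} (ht : t < d) :
    T.path χ t ∈ T.support ↔ ∀ s ≤ t, χ s = 0 := by
  unfold path
  split_ifs with h
  · exact iff_of_true (T.word_mem t ht) h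
  · exact iff_of_false (T.fresh_notMem t ht _) h

theorem path_eq_fresh_iff {χ : ℕ → Fin K} {t s : ℕ} {i : Fin K} (ht : t < d) (hs : s < d) :
    T.path χ s = T.fresh t i ↔ s = t ∧ χ s = i ∧ ¬ ∀ r ≤ s, χ r = 0 := by
  unfold path
  split_ifs with h
  · exact iff_of_false (fun h' => T.fresh_notMem t ht i (h' ▸ T.word_mem s hs))
      fun h' => h'.2.2 h
  · constructor
    · intro h'
      exact ⟨(T.fresh_inj s hs t ht _ _ h').1, (T.fresh_inj s hs t ht _ _ h').2, h⟩
    · rintro ⟨rfl, rfl, -⟩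
      rfl

theorem path_mem_query_and_unique {Q₀ : Finset (Fin n)} {χ : ℕ → Fin K} {t : ℕ} (ht : t < d) :
    T.path χ t ∈ T.query Q₀ ((List.range t).reverse.map (T.path χ)) ∧
      ∀ s, t ≤ s → s < d → T.path χ s ∈ T.query Q₀ ((List.range t).reverse.map (T.path χ)) →
        T.path χ s = T.path χ t := by
  have hon : (∀ x ∈ (List.range t).reverse.map (T.path χ), x ∈ T.support) ↔
      ∀ r < t, χ r = 0 := by
    simp only [List.mem_map, List.mem_reverse, List.mem_range, forall_exists_index, and_imp,
      forall_apply_eq_imp_iff₂]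
    constructor
    · exact fun h r hr => (path_mem_support_iff (hr.trans ht)).1 (h r hr) r le_rfl
    · exact fun h r hr => (path_mem_support_iff (hr.trans ht)).2
        fun r' hr' => h r' (hr'.trans_lt hr)
  simp only [query, List.length_map, List.length_reverse, List.length_range, if_pos ht, hon]
  split_ifs with h
  · simp only [Finset.mem_insert, Finset.mem_image, Finset.mem_erase, Finset.mem_univ, and_true]
    have hall : χ t = 0 → ∀ s ≤ t, χ s = 0 := fun h0 s hs =>
      hs.eq_or_lt.elim (fun e => e ▸ h0) (h s)
    constructor
    · by_cases h0 : χ t = 0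
      · left
        rw [path, if_pos (hall h0)]
      · right
        exact ⟨χ t, h0, ((path_eq_fresh_iff ht ht).2
          ⟨rfl, rfl, fun h' => h0 (h' t le_rfl)⟩).symm⟩
    · rintro s hts hsd (hw | ⟨i, hi, hf⟩)
      · have := (path_mem_support_iff hsd).1 (hw ▸ T.word_mem t ht)
        rw [hw, path, if_pos fun r hr => this r (hr.trans hts)]
      · rw [((path_eq_fresh_iff ht hsd).1 hf.symm).1]
  · simp only [Finset.mem_image, Finset.mem_univ, true_and]
    constructor
    · exact ⟨χ t, ((path_eq_fresh_iff ht ht).2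
        ⟨rfl, rfl, fun h' => h fun r hr => h' r hr.le⟩).symm⟩
    · rintro s hts hsd ⟨i, hf⟩
      rw [((path_eq_fresh_iff ht hsd).1 hf.symm).1]

theorem isForced_path (Q₀ : Finset (Fin n)) (χ : ℕ → Fin K) (m t : ℕ) (h : t + m = d) :
    IsForced (T.query Q₀) ((List.range t).reverse.map (T.path χ))
      ((List.range' t m).map (T.path χ)) := by
  induction m generalizing t with
  | zero => simp [IsForced]
  | succ m ih =>
    rw [List.range'_succ, List.map_cons]
    obtain ⟨h1, h2⟩ := path_mem_query_and_unique (T := T) (Q₀ := Q₀) (χ := χ) (t := t) (by omega)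
    refine ⟨h1, ?_, ?_⟩
    · intro x hx hxQ
      obtain ⟨s, hs, rfl⟩ := List.mem_map.1 hx
      rw [List.mem_range'_1] at hs
      exact h2 s (by omega) (by omega) hxQ
    · have := ih (t + 1) (by omega)
      rwa [List.range_succ, List.reverse_append, List.reverse_singleton, List.singleton_append,
        List.map_cons] at this

/-- The choices along a branch of the tree, continued by zeros. -/
def extend (χ : Fin d → Fin K) (t : ℕ) : Fin K := if h : t < d then χ ⟨t, h⟩ else 0

theorem extend_of_lt (χ : Fin d → Fin K) {t : ℕ} (h : t < d) : extend χ t = χ ⟨t, h⟩ := dif_pos h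

variable (T) in
/-- The allocation at the end of the branch `χ`. -/
def leaf (χ : Fin d → Fin K) : Allocation n d :=
  ⟨(Multiset.range d).map (T.path (extend χ)), by simp⟩

theorem coe_leaf (χ : Fin d → Fin K) :
    (T.leaf χ : Multiset (Fin n)) = (Multiset.range d).map (T.path (extend χ)) := rfl

theorem mem_leaf {χ : Fin d → Fin K} {x : Fin n} :
    x ∈ (T.leaf χ : Multiset (Fin n)) ↔ ∃ t < d, T.path (extend χ) t = x := by
  simp [coe_leaf]

theorem leaf_injective : Function.Injective T.leaf := by
  have key : ∀ χ χ' : Fin d → Fin K, T.leaf χ = T.leaf χ' → ∀ t, χ t ≠ 0 → χ' t = χ t := by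
    intro χ χ' h t ht
    have h1 : T.fresh t (χ t) ∈ (T.leaf χ : Multiset (Fin n)) := by
      refine mem_leaf.2 ⟨t, t.2, (path_eq_fresh_iff t.2 t.2).2 ⟨rfl, extend_of_lt χ t.2, ?_⟩⟩
      intro h'
      exact ht ((extend_of_lt χ t.2).symm.trans (h' t le_rfl))
    rw [h, mem_leaf] at h1
    obtain ⟨s, hs, hp⟩ := h1
    obtain ⟨rfl, h2, -⟩ := (path_eq_fresh_iff t.2 hs).1 hp
    rwa [extend_of_lt χ' hs] at h2
  intro χ χ' h
  funext t
  by_cases h0 : χ t = 0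
  · by_contra h1
    exact h1 (key χ' χ h.symm t fun h2 => h1 (h0.trans h2.symm))
  · exact (key χ χ' h t h0).symm

theorem coe_leaf_zero :
    (T.leaf 0 : Multiset (Fin n)) = (Multiset.range d).map T.word := by
  rw [coe_leaf]
  refine Multiset.map_congr rfl fun t _ => ?_
  simp [path, extend]

/-- For every search tree there is one strategy that wins, whatever the hider reveals, with
probability `(k / K) ^ d` against the allocation at any leaf of the tree. -/
theorem exists_strategy (hk : 0 < k) (hK : k ≤ K) (hn : K ≤ n) (T : TreeData n d K) :
    ∃ σ : SearchStrategy n k, ∀ (τ : HideStrategy n d) (χ : Fin d → Fin K),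
      (k / K) ^ d ≤ winProbFrom σ τ (T.leaf χ) d [] := by
  obtain ⟨Q₀, -, hQ₀⟩ := Finset.exists_subset_card_eq (s := (Finset.univ : Finset (Fin n)))
    (n := K) (by simpa using hn)
  refine ⟨plannedSearch hk hK (T.query Q₀) (card_query hQ₀), fun τ χ => ?_⟩
  have hf := isForced_path (T := T) Q₀ (extend χ) d 0 (by simp)
  have := hf.le_winProbFrom hk hK (card_query hQ₀) τ (T.leaf χ) _ [] (by
    rw [coe_leaf, ← Multiset.coe_range, List.range_eq_range']
    simp)
  simpa using this

/-- Renaming of the boxes. -/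
def map (T : TreeData n d K) (π : Equiv.Perm (Fin n)) : TreeData n d K where
  word t := π (T.word t)
  support := T.support.map π.toEmbedding
  word_mem t ht := by simpa using T.word_mem t ht
  fresh t i := π (T.fresh t i)
  fresh_notMem t ht i := by simpa using T.fresh_notMem t ht i
  fresh_inj t ht t' ht' i i' h := T.fresh_inj t ht t' ht' i i' (π.injective h)

theorem leaf_map (π : Equiv.Perm (Fin n)) (χ : Fin d → Fin K) :
    (T.map π).leaf χ = Sym.map π (T.leaf χ) := by
  apply Sym.ext
  rw [Sym.coe_map, coe_leaf, coe_leaf, Multiset.map_map]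
  refine Multiset.map_congr rfl fun t _ => ?_
  simp only [path, map, Function.comp]
  split_ifs <;> rfl

end TreeData

/-- The number of boxes that contain a treasure. -/
def occupied (a : Allocation n d) : ℕ := (a : Multiset (Fin n)).toFinset.card

namespace TreeData

variable {K : ℕ} [NeZero K] {T : TreeData n d K}

/-- A branch that leaves the word at level `t` reaches `d - t` fresh boxes. -/
theorem le_occupied_leaf {χ : Fin d → Fin K} (hχ : χ ≠ 0) :
    ∃ t < d, ((Finset.range t).image T.word).card + (d - t) ≤ occupied (T.leaf χ) := by
  have hex : ∃ t, extend χ t ≠ 0 := by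
    by_contra! H
    refine hχ (funext fun t => ?_)
    rw [← extend_of_lt χ t.2, H]
    rfl
  classical
  set t := Nat.find hex with ht
  have ht0 : extend χ t ≠ 0 := Nat.find_spec hex
  have hmin : ∀ s < t, extend χ s = 0 := fun s hs => not_not.1 (Nat.find_min hex hs)
  have htd : t < d := by
    by_contra h
    exact ht0 (dif_neg h)
  refine ⟨t, htd, ?_⟩
  have hfresh : ∀ s, t ≤ s → T.path (extend χ) s = T.fresh s (extend χ s) := fun s hs =>
    if_neg fun h => ht0 (h t hs)
  have hdisj : Disjoint ((Finset.range t).image T.word)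
      ((Finset.Ico t d).image (T.path (extend χ))) := by
    rw [Finset.disjoint_left]
    intro x hx hx'
    obtain ⟨r, hr, rfl⟩ := Finset.mem_image.1 hx
    obtain ⟨s, hs, hsr⟩ := Finset.mem_image.1 hx'
    rw [Finset.mem_range] at hr
    rw [Finset.mem_Ico] at hs
    rw [hfresh s hs.1] at hsr
    exact T.fresh_notMem s hs.2 _ (hsr ▸ T.word_mem r (hr.trans htd))
  have hcard : ((Finset.Ico t d).image (T.path (extend χ))).card = d - t := by
    rw [Finset.card_image_of_injOn, Nat.card_Ico]
    intro r hr s hs h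
    simp only [Finset.coe_Ico, Set.mem_Ico] at hr hs
    rw [hfresh r hr.1, hfresh s hs.1] at h
    exact (T.fresh_inj r hr.2 s hs.2 _ _ h).1
  rw [← hcard, ← Finset.card_union_of_disjoint hdisj]
  refine Finset.card_le_card ?_
  intro x hx
  rw [Multiset.mem_toFinset, mem_leaf]
  rcases Finset.mem_union.1 hx with h | h
  · obtain ⟨r, hr, rfl⟩ := Finset.mem_image.1 h
    rw [Finset.mem_range] at hr
    exact ⟨r, hr.trans htd, if_pos fun s hs => hmin s (hs.trans_lt hr)⟩
  · obtain ⟨r, hr, rfl⟩ := Finset.mem_image.1 h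
    exact ⟨r, (Finset.mem_Ico.1 hr).2, rfl⟩

theorem occupied_leaf_zero : occupied (T.leaf 0) = ((Finset.range d).image T.word).card := by
  rw [occupied, coe_leaf_zero]
  rfl

/-- If the last letter of the word is a repetition, then no branch has as few occupied boxes as the
word itself. -/
theorem occupied_lt_of_repeat {s : ℕ} (hs : s + 1 < d) (hw : T.word s = T.word (d - 1))
    {χ : Fin d → Fin K} (hχ : χ ≠ 0) : occupied (T.leaf 0) < occupied (T.leaf χ) := by
  obtain ⟨t, ht, hle⟩ := le_occupied_leaf (T := T) hχ
  rw [occupied_leaf_zero]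
  have hsub : (Finset.range d).image T.word ⊆
      (Finset.range t).image T.word ∪ (Finset.Ico t (d - 1)).image T.word := by
    intro x hx
    obtain ⟨r, hr, rfl⟩ := Finset.mem_image.1 hx
    rw [Finset.mem_range] at hr
    obtain ⟨r', hr', hrr⟩ : ∃ r' < d - 1, T.word r' = T.word r := by
      rcases Nat.lt_or_ge r (d - 1) with h | h
      · exact ⟨r, h, rfl⟩
      · exact ⟨s, by omega, by rw [hw]; congr 1; omega⟩
    rw [← hrr, Finset.mem_union]
    rcases Nat.lt_or_ge r' t with h | h
    · exact Or.inl (Finset.mem_image_of_mem _ (by simpa using h))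
    · exact Or.inr (Finset.mem_image_of_mem _ (by simp [h, hr']))
  have h1 := (Finset.card_le_card hsub).trans (Finset.card_union_le _ _)
  have h2 := Finset.card_image_le (s := Finset.Ico t (d - 1)) (f := T.word)
  rw [Nat.card_Ico] at h2
  omega

theorem occupied_leaf_of_injOn (hw : Set.InjOn T.word (Finset.range d : Finset ℕ))
    (χ : Fin d → Fin K) : occupied (T.leaf χ) = d := by
  apply le_antisymm
  · exact (Multiset.toFinset_card_le _).trans_eq (by simp)
  · rcases eq_or_ne χ 0 with rfl | hχ
    · rw [occupied_leaf_zero, Finset.card_image_of_injOn hw, Finset.card_range]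
    · obtain ⟨t, ht, hle⟩ := le_occupied_leaf (T := T) hχ
      rw [Finset.card_image_of_injOn (hw.mono (by
        intro x hx
        simp at hx ⊢
        omega)), Finset.card_range] at hle
      omega

end TreeData

/-- The treasures can be listed such that either all boxes are distinct or the last one is a
repetition. -/
theorem exists_word (hn : 0 < n) (a : Allocation n d) :
    ∃ w : ℕ → Fin n, (Multiset.range d).map w = (a : Multiset (Fin n)) ∧
      (Set.InjOn w (Finset.range d : Finset ℕ) ∨ ∃ s, s + 1 < d ∧ w s = w (d - 1)) := by
  have hlist : ∀ l : List (Fin n), l.length = d →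
      (Multiset.range d).map (fun t => l.getD t ⟨0, hn⟩) = l := by
    intro l hl
    rw [← Multiset.coe_range, Multiset.map_coe]
    congr 1
    apply List.ext_getElem
    · simp [hl]
    · intro i h1 h2
      simp [h2]
  by_cases hnd : (a : Multiset (Fin n)).Nodup
  · have hl : (a : Multiset (Fin n)).toList.length = d := by simp
    refine ⟨_, (hlist _ hl).trans (Multiset.coe_toList _), Or.inl ?_⟩
    intro r hr s hs h
    simp only [Finset.coe_range, Set.mem_Iio] at hr hs
    have hnd' : (a : Multiset (Fin n)).toList.Nodup := by
      rw [← Multiset.coe_nodup, Multiset.coe_toList]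
      exact hnd
    rw [← hl] at hr hs
    simp only [List.getD_eq_getElem _ _ hr, List.getD_eq_getElem _ _ hs] at h
    exact (hnd'.getElem_inj_iff).1 h
  · rw [Multiset.nodup_iff_ne_cons_cons] at hnd
    push Not at hnd
    obtain ⟨x, b, hb⟩ := hnd
    have hcard : b.card + 2 = d := by
      have := congrArg Multiset.card hb
      simp at this
      omega
    have hl : (b.toList ++ [x, x]).length = d := by simp [hcard]
    refine ⟨_, (hlist _ hl).trans ?_, Or.inr ⟨b.card, by omega, ?_⟩⟩
    · rw [hb, ← Multiset.coe_add, Multiset.coe_toList, add_comm, ← Multiset.cons_coe,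
        ← Multiset.cons_coe, Multiset.cons_add, Multiset.cons_add, Multiset.coe_nil, zero_add]
    · have : d - 1 = b.card + 1 := by omega
      simp [this]

/-- If there are enough boxes, then each allocation is the end of the main branch of a tree whose
other leaves have more occupied boxes, or else all leaves have `d` occupied boxes. -/
theorem exists_treeData {K : ℕ} [NeZero K] (hn : d + d * K < n) (a : Allocation n d) :
    ∃ T : TreeData n d K, T.leaf 0 = a ∧ ∀ χ ≠ 0, occupied a < occupied (T.leaf χ) ∨
      (occupied a = d ∧ occupied (T.leaf χ) = d) := by
  obtain ⟨w, hwa, hw⟩ := exists_word (by omega) a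
  set S : Finset (Fin n) := (a : Multiset (Fin n)).toFinset with hS
  have hScard : S.card ≤ d := (Multiset.toFinset_card_le _).trans_eq (by simp)
  have hemb : Nonempty (Fin d × Fin K ↪ {x : Fin n // x ∉ S}) := by
    apply Function.Embedding.nonempty_of_card_le
    rw [Fintype.card_subtype_compl]
    simp
    omega
  obtain ⟨F⟩ := hemb
  let T : TreeData n d K :=
    { word := w
      support := S
      word_mem := fun t ht => by
        rw [hS, Multiset.mem_toFinset, ← hwa]
        exact Multiset.mem_map_of_mem _ (by simpa using ht)
      fresh := fun t i => if h : t < d then F (⟨t, h⟩, i) else ⟨0, by omega⟩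
      fresh_notMem := fun t ht i => by
        rw [dif_pos ht]
        exact (F _).2
      fresh_inj := fun t ht t' ht' i i' h => by
        rw [dif_pos ht, dif_pos ht'] at h
        simpa using F.injective (Subtype.ext h) }
  have hleaf : T.leaf 0 = a := Sym.ext (TreeData.coe_leaf_zero.trans hwa)
  refine ⟨T, hleaf, fun χ hχ => ?_⟩
  rcases hw with hw | ⟨s, hs, hsw⟩
  · refine Or.inr ⟨?_, TreeData.occupied_leaf_of_injOn hw χ⟩
    rw [← hleaf]
    exact TreeData.occupied_leaf_of_injOn hw 0
  · left
    rw [← hleaf]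
    exact TreeData.occupied_lt_of_repeat hs hsw hχ

/-! ### A triangular system of equations -/

/-- A triangular system has a nonnegative solution if the right-hand side grows fast enough with
the rank. -/
theorem exists_nonneg_solution {Λ : Type*} [Fintype Λ] (rank : Λ → ℕ) (M : Λ → Λ → ℝ)
    (N : Λ → ℝ) (D : ℝ) (hM : ∀ i j, 0 ≤ M i j) (hMD : ∀ i j, M i j ≤ D)
    (hdiag : ∀ i, 1 ≤ M i i) (htri : ∀ i j, i ≠ j → M i j ≠ 0 → rank i < rank j)
    (hN : ∀ i, 0 ≤ N i) (hgrow : ∀ j, ∑ i with rank i < rank j, D * N i ≤ N j) :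
    ∃ c : Λ → ℝ, (∀ i, 0 ≤ c i) ∧ ∀ j, ∑ i, c i * M i j = N j := by
  classical
  have hsum : ∀ (c : Λ → ℝ) (j : Λ),
      ∑ i, c i * M i j = c j * M j j + ∑ i with rank i < rank j, c i * M i j := by
    intro c j
    rw [← Finset.add_sum_erase _ _ (Finset.mem_univ j)]
    congr 1
    symm
    apply Finset.sum_subset
    · intro i hi
      simp only [Finset.mem_filter, Finset.mem_univ, true_and, Finset.mem_erase, and_true] at hi ⊢
      rintro rfl
      exact lt_irrefl _ hi
    · intro i hi hi'
      simp only [Finset.mem_filter, Finset.mem_univ, true_and, Finset.mem_erase, and_true] at hi hi'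
      by_contra h
      exact hi' (htri i j hi (right_ne_zero_of_mul h))
  have step : ∀ r : ℕ, ∃ c : Λ → ℝ, (∀ i, 0 ≤ c i ∧ c i ≤ N i) ∧
      ∀ j, rank j < r → ∑ i, c i * M i j = N j := by
    intro r
    induction r with
    | zero => exact ⟨0, fun i => ⟨le_rfl, hN i⟩, fun j hj => absurd hj (Nat.not_lt_zero _)⟩
    | succ r ih =>
      obtain ⟨c, hc, hcr⟩ := ih
      -- The equations of rank `r` are solved for the diagonal unknowns.
      let c' : Λ → ℝ := fun j => if rank j = r then
        (N j - ∑ i with rank i < rank j, c i * M i j) / M j j else c j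
      have hlow : ∀ i, rank i < r → c' i = c i := fun i hi => if_neg hi.ne
      refine ⟨c', fun j => ?_, fun j hj => ?_⟩
      · by_cases hj : rank j = r
        · have h0 : 0 ≤ ∑ i with rank i < rank j, c i * M i j :=
            Finset.sum_nonneg fun i _ => mul_nonneg (hc i).1 (hM i j)
          have h1 : ∑ i with rank i < rank j, c i * M i j ≤ N j := by
            refine le_trans (Finset.sum_le_sum fun i _ => ?_) (hgrow j)
            rw [mul_comm D]
            exact mul_le_mul (hc i).2 (hMD i j) (hM i j) (hN i)
          simp only [c', if_pos hj]
          refine ⟨div_nonneg (by linarith) (hM j j), ?_⟩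
          exact (div_le_self (by linarith) (hdiag j)).trans (by linarith)
        · simpa only [c', if_neg hj] using hc j
      · have hsum' : ∑ i with rank i < rank j, c' i * M i j =
            ∑ i with rank i < rank j, c i * M i j := by
          refine Finset.sum_congr rfl fun i hi => ?_
          rw [hlow i (by have := (Finset.mem_filter.1 hi).2; omega)]
        rw [hsum, hsum']
        by_cases hjr : rank j = r
        · have : M j j ≠ 0 := (zero_lt_one.trans_le (hdiag j)).ne'
          simp only [c', if_pos hjr]
          rw [div_mul_cancel₀ _ this]
          ring
        · rw [hlow j (by omega), ← hsum, hcr j (by omega)]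
  obtain ⟨c, hc, hcr⟩ := step (Finset.univ.sup rank + 1)
  exact ⟨c, fun i => (hc i).1, fun j =>
    hcr j (Nat.lt_succ_of_le (Finset.le_sup (Finset.mem_univ j)))⟩

/-! ### Renaming the boxes -/

/-- Two allocations are equivalent if they agree up to renaming of the boxes. -/
def renamingSetoid (n d : ℕ) : Setoid (Allocation n d) where
  r a b := ∃ π : Equiv.Perm (Fin n), Sym.map π a = b
  iseqv :=
    { refl := fun a => ⟨1, by simp⟩
      symm := by
        rintro a _ ⟨π, rfl⟩
        exact ⟨π⁻¹, by simp [Sym.map_map]⟩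
      trans := by
        rintro a _ _ ⟨π, rfl⟩ ⟨ρ, rfl⟩
        exact ⟨ρ * π, by rw [Sym.map_map, Equiv.Perm.coe_mul]⟩ }

/-- Allocations up to renaming of the boxes. -/
abbrev Shape (n d : ℕ) : Type := Quotient (renamingSetoid n d)

/-- The shape of an allocation. -/
def shape (a : Allocation n d) : Shape n d := Quotient.mk (renamingSetoid n d) a

theorem shape_eq_iff {a b : Allocation n d} :
    shape a = shape b ↔ ∃ π : Equiv.Perm (Fin n), Sym.map π a = b := Quotient.eq

theorem shape_map (π : Equiv.Perm (Fin n)) (a : Allocation n d) :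
    shape (Sym.map π a) = shape a := (shape_eq_iff.2 ⟨π, rfl⟩).symm

theorem exists_shape_eq (o : Shape n d) : ∃ a, shape a = o := Quotient.exists_rep o

noncomputable instance : DecidableEq (Shape n d) := Classical.decEq _

noncomputable instance : Fintype (Shape n d) :=
  Fintype.ofSurjective (shape : Allocation n d → Shape n d) exists_shape_eq

/-- The allocations of a given shape. -/
noncomputable def ofShape (o : Shape n d) : Finset (Allocation n d) :=
  Finset.univ.filter fun a => shape a = o

theorem mem_ofShape {o : Shape n d} {a : Allocation n d} : a ∈ ofShape o ↔ shape a = o := by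
  simp [ofShape]

/-- The renamings that move some allocation from the set `W` to `b`. -/
noncomputable def renamingsOnto (W : Finset (Allocation n d)) (b : Allocation n d) :
    Finset (Equiv.Perm (Fin n)) :=
  Finset.univ.filter fun π => ∃ a ∈ W, Sym.map π a = b

theorem card_renamingsOnto_map (W : Finset (Allocation n d)) (b : Allocation n d)
    (ρ : Equiv.Perm (Fin n)) :
    (renamingsOnto W (Sym.map ρ b)).card = (renamingsOnto W b).card := by
  symm
  refine Finset.card_bij (fun π _ => ρ * π) ?_ (fun π _ π' _ h => mul_left_cancel h) ?_
  · intro π hπ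
    simp only [renamingsOnto, Finset.mem_filter, Finset.mem_univ, true_and] at hπ ⊢
    obtain ⟨a, ha, rfl⟩ := hπ
    exact ⟨a, ha, by rw [Sym.map_map, Equiv.Perm.coe_mul]⟩
  · intro π hπ
    simp only [renamingsOnto, Finset.mem_filter, Finset.mem_univ, true_and] at hπ ⊢
    obtain ⟨a, ha, h⟩ := hπ
    refine ⟨ρ⁻¹ * π, ⟨a, ha, ?_⟩, by simp⟩
    rw [Equiv.Perm.coe_mul, ← Sym.map_map, h, Sym.map_map, ← Equiv.Perm.coe_mul]
    simp

/-- Under a uniformly random renaming the allocations from `W` are uniformly distributed within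
their shape. -/
theorem card_ofShape_mul_card_renamingsOnto (W : Finset (Allocation n d)) (b : Allocation n d) :
    (ofShape (shape b)).card * (renamingsOnto W b).card =
      n.factorial * (W.filter fun a => shape a = shape b).card := by
  classical
  calc (ofShape (shape b)).card * (renamingsOnto W b).card
      = ∑ b' ∈ ofShape (shape b), (renamingsOnto W b').card := by
        rw [← smul_eq_mul, ← Finset.sum_const]
        refine Finset.sum_congr rfl fun b' hb' => ?_
        obtain ⟨ρ, rfl⟩ := shape_eq_iff.1 (mem_ofShape.1 hb').symm
        rw [card_renamingsOnto_map]
    _ = ∑ π : Equiv.Perm (Fin n),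
          ((ofShape (shape b)).filter fun b' => ∃ a ∈ W, Sym.map π a = b').card := by
        simp only [renamingsOnto]
        exact Finset.sum_card_bipartiteAbove_eq_sum_card_bipartiteBelow
          (fun b' (π : Equiv.Perm (Fin n)) => ∃ a ∈ W, Sym.map π a = b')
    _ = ∑ π : Equiv.Perm (Fin n), (W.filter fun a => shape a = shape b).card := by
        refine Finset.sum_congr rfl fun π _ => ?_
        rw [← Finset.card_image_of_injective (W.filter fun a => shape a = shape b)
          (Sym.map_injective π.injective d)]
        congr 1
        ext b'
        simp only [Finset.mem_filter, mem_ofShape, Finset.mem_image]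
        constructor
        · rintro ⟨h, a, ha, rfl⟩
          exact ⟨a, ⟨ha, by rwa [shape_map] at h⟩, rfl⟩
        · rintro ⟨a, ⟨ha, h⟩, rfl⟩
          exact ⟨by rwa [shape_map], a, ha, rfl⟩
    _ = n.factorial * (W.filter fun a => shape a = shape b).card := by
        rw [Finset.sum_const, smul_eq_mul, Finset.card_univ, Fintype.card_perm, Fintype.card_fin]

theorem toFinset_map (a : Allocation n d) (π : Equiv.Perm (Fin n)) :
    (Sym.map π a : Multiset (Fin n)).toFinset = (a : Multiset (Fin n)).toFinset.image π := by
  ext x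
  simp

theorem occupied_map (a : Allocation n d) (π : Equiv.Perm (Fin n)) :
    occupied (Sym.map π a) = occupied a := by
  rw [occupied, toFinset_map, Finset.card_image_of_injective _ π.injective, occupied]

theorem occupied_le (a : Allocation n d) : occupied a ≤ d :=
  (Multiset.toFinset_card_le _).trans_eq (by simp)

/-- The number of boxes that are occupied in the allocations of a given shape. -/
def Shape.occupied (o : Shape n d) : ℕ :=
  Quotient.lift CachingGame.occupied (by
    rintro a _ ⟨π, rfl⟩
    exact (occupied_map a π).symm) o

theorem occupied_shape (a : Allocation n d) : (shape a).occupied = occupied a := rfl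

theorem exists_perm_image_eq {S S' : Finset (Fin n)} (h : S.card = S'.card) :
    ∃ π : Equiv.Perm (Fin n), S.image π = S' := by
  refine ⟨(Finset.equivOfCardEq h).extendSubtype, ?_⟩
  refine Finset.eq_of_subset_of_card_le (fun x hx => ?_) ?_
  · obtain ⟨y, hy, rfl⟩ := Finset.mem_image.1 hx
    exact Equiv.extendSubtype_mem (Finset.equivOfCardEq h) y hy
  · rw [Finset.card_image_of_injective _ (Equiv.injective _), h]

theorem shape_eq_of_occupied_eq {a b : Allocation n d} (ha : occupied a = d)
    (hb : occupied b = d) : shape a = shape b := by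
  obtain ⟨π, hπ⟩ := exists_perm_image_eq (ha.trans hb.symm)
  rw [← toFinset_map] at hπ
  refine shape_eq_iff.2 ⟨π, Sym.ext ?_⟩
  have hnd : ∀ c : Allocation n d, occupied c = d → (c : Multiset (Fin n)).Nodup := fun c hc =>
    Multiset.toFinset_card_eq_card_iff_nodup.1 (hc.trans (by simp))
  have h := congrArg Finset.val hπ
  rwa [Multiset.toFinset_val, Multiset.toFinset_val, (hnd _ ((occupied_map a π).trans ha)).dedup,
    (hnd b hb).dedup] at h

/-! ### Counting allocations -/

theorem choose_le_card_ofShape (a : Allocation n d) :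
    n.choose (occupied a) ≤ (ofShape (shape a)).card := by
  have h : (Finset.powersetCard (occupied a) (Finset.univ : Finset (Fin n))).card =
      n.choose (occupied a) := by simp
  rw [← h]
  refine Finset.card_le_card_of_surjOn (fun b => (b : Multiset (Fin n)).toFinset) ?_
  intro S hS
  obtain ⟨π, hπ⟩ := exists_perm_image_eq (Finset.mem_powersetCard.1 hS).2.symm
  exact ⟨Sym.map π a, mem_ofShape.2 (shape_map π a), (toFinset_map a π).trans hπ⟩

theorem card_occupied_le (hn : 0 < n) {m : ℕ} (hm : m ≤ n) :
    (Finset.univ.filter fun a : Allocation n d => occupied a ≤ m).card ≤ n ^ m * m ^ d := by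
  have h : (Finset.univ : Finset ((Fin m → Fin n) × (Fin d → Fin m))).card = n ^ m * m ^ d := by
    simp
  rw [← h]
  refine Finset.card_le_card_of_surjOn (fun p => (⟨(Multiset.range d).map fun t =>
    if ht : t < d then p.1 (p.2 ⟨t, ht⟩) else ⟨0, hn⟩, by simp⟩ : Allocation n d)) ?_
  intro a ha
  have ha : occupied a ≤ m := by simpa using ha
  obtain ⟨w, hw, -⟩ := exists_word hn a
  -- The occupied boxes are contained in a set of `m` boxes.
  obtain ⟨S, hS, hScard⟩ := Finset.exists_superset_card_eq ha (by simpa using hm)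
  have hwS : ∀ t < d, w t ∈ S := fun t ht => hS (by
    rw [Multiset.mem_toFinset, ← hw]
    exact Multiset.mem_map_of_mem _ (by simpa using ht))
  let e := S.equivFinOfCardEq hScard
  refine ⟨(fun i => e.symm i, fun t => e ⟨w t, hwS t t.2⟩), by simp, Sym.ext ?_⟩
  rw [← hw]
  change (Multiset.range d).map _ = _
  refine Multiset.map_congr rfl fun t ht => ?_
  simp [Multiset.mem_range.1 ht]

theorem mul_pow_le_choose {B m : ℕ} (hn : 2 * m ≤ n)
    (hB : B * (2 ^ (m + 1) * (m + 1).factorial) ≤ n) : B * n ^ m ≤ n.choose (m + 1) := by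
  have h1 : (n + 1 - (m + 1)) ^ (m + 1) ≤ (m + 1).factorial * n.choose (m + 1) := by
    have := Nat.pow_le_choose (α := ℚ) (m + 1) n
    rw [div_le_iff₀ (by positivity)] at this
    rw [mul_comm]
    exact_mod_cast this
  have h2 : n ≤ 2 * (n + 1 - (m + 1)) := by omega
  have h3 : 0 < 2 ^ (m + 1) * (m + 1).factorial := by positivity
  refine Nat.le_of_mul_le_mul_left ?_ h3
  calc 2 ^ (m + 1) * (m + 1).factorial * (B * n ^ m)
      = B * (2 ^ (m + 1) * (m + 1).factorial) * n ^ m := by ring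
    _ ≤ n * n ^ m := by gcongr
    _ = n ^ (m + 1) := by ring
    _ ≤ (2 * (n + 1 - (m + 1))) ^ (m + 1) := by gcongr
    _ = 2 ^ (m + 1) * (n + 1 - (m + 1)) ^ (m + 1) := by ring
    _ ≤ 2 ^ (m + 1) * ((m + 1).factorial * n.choose (m + 1)) := by gcongr
    _ = _ := by ring

/-- If there are many boxes, then each shape has many more allocations than all shapes with fewer
occupied boxes together. -/
theorem mul_card_occupied_lt_le_card_ofShape {D : ℕ} (hn0 : 0 < n) (hn : 2 * d ≤ n)
    (hD : D * d ^ d * (2 ^ d * d.factorial) ≤ n) (a : Allocation n d) :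
    D * (Finset.univ.filter fun b : Allocation n d => occupied b < occupied a).card ≤
      (ofShape (shape a)).card := by
  rcases Nat.eq_zero_or_pos (occupied a) with h0 | h0
  · simp [h0]
  · obtain ⟨m, hm⟩ : ∃ m, occupied a = m + 1 := ⟨occupied a - 1, by omega⟩
    have hmd : m + 1 ≤ d := hm ▸ occupied_le a
    refine le_trans ?_ (choose_le_card_ofShape a)
    simp only [hm, Nat.lt_succ_iff]
    calc D * (Finset.univ.filter fun b : Allocation n d => occupied b ≤ m).card
        ≤ D * (n ^ m * m ^ d) := by
          gcongr
          exact card_occupied_le hn0 (by omega)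
      _ = D * m ^ d * n ^ m := by ring
      _ ≤ n.choose (m + 1) := by
          refine mul_pow_le_choose (by omega) (le_trans ?_ hD)
          gcongr
          · omega
          · norm_num

/-! ### The optimal search strategy -/

/-- There are weights of the shapes such that the trees around these shapes, with these weights and
a random renaming of the boxes, have each allocation as a leaf equally often. -/
theorem exists_weights {K : ℕ} [NeZero K] (hn0 : 0 < n) (hn : 2 * d ≤ n)
    (hD : K ^ d * d ^ d * (2 ^ d * d.factorial) ≤ n) (T : Shape n d → TreeData n d K)
    (hT0 : ∀ o, shape ((T o).leaf 0) = o)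
    (hT : ∀ o, ∀ χ ≠ 0, o.occupied < occupied ((T o).leaf χ) ∨
      (o.occupied = d ∧ occupied ((T o).leaf χ) = d)) :
    ∃ c : Shape n d → ℝ, (∀ o, 0 ≤ c o) ∧ ∀ o', ∑ o, c o *
      (((Finset.univ.image (T o).leaf).filter fun a => shape a = o').card : ℝ) =
        (ofShape o').card := by
  have hcard : ∀ o, (Finset.univ.image (T o).leaf).card = K ^ d := fun o => by
    rw [Finset.card_image_of_injective _ TreeData.leaf_injective]
    simp
  refine exists_nonneg_solution Shape.occupied _ _ ((K ^ d : ℕ) : ℝ)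
    (fun o o' => Nat.cast_nonneg _) ?_ ?_ ?_ (fun o => Nat.cast_nonneg _) ?_
  · intro o o'
    rw [← hcard o]
    exact_mod_cast Finset.card_filter_le _ _
  · intro o
    norm_cast
    refine Finset.card_pos.2 ⟨(T o).leaf 0, ?_⟩
    simp [hT0 o]
  · intro o o' hne h
    have : (((Finset.univ.image (T o).leaf).filter fun a => shape a = o')).Nonempty := by
      rw [← Finset.card_pos]
      exact Nat.pos_of_ne_zero (by exact_mod_cast h)
    obtain ⟨a, ha⟩ := this
    simp only [Finset.mem_filter, Finset.mem_image, Finset.mem_univ, true_and] at ha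
    obtain ⟨⟨χ, rfl⟩, rfl⟩ := ha
    have hχ : χ ≠ 0 := by
      rintro rfl
      exact hne (hT0 o).symm
    rcases hT o χ hχ with h1 | ⟨h1, h2⟩
    · exact h1
    · have h0 : occupied ((T o).leaf 0) = d := by rw [← occupied_shape, hT0, h1]
      exact absurd ((hT0 o).symm.trans (shape_eq_of_occupied_eq h0 h2)) hne
  · intro o'
    obtain ⟨a, rfl⟩ := exists_shape_eq o'
    rw [← Finset.mul_sum]
    refine le_trans ?_ (Nat.cast_le.2 (mul_card_occupied_lt_le_card_ofShape hn0 hn hD a))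
    rw [Nat.cast_mul, ← Nat.cast_sum]
    gcongr
    rw [Finset.card_eq_sum_card_fiberwise (f := shape)
      (s := Finset.univ.filter fun b : Allocation n d => occupied b < occupied a)
      (t := Finset.univ.filter fun o : Shape n d => o.occupied < (shape a).occupied)
      (fun b hb => Finset.mem_filter.2 ⟨Finset.mem_univ _, (Finset.mem_filter.1 hb).2⟩)]
    refine Finset.sum_le_sum fun o ho => Finset.card_le_card fun b hb => ?_
    rw [mem_ofShape] at hb
    subst hb
    exact Finset.mem_filter.2
      ⟨Finset.mem_filter.2 ⟨Finset.mem_univ _, (Finset.mem_filter.1 ho).2⟩, rfl⟩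

/-- If there are enough boxes, then the searcher can win with probability at least
`k ^ d / #(Allocation n d)` against each allocation. -/
theorem exists_searchStrategy {K : ℕ} [NeZero K] (hk : 0 < k) (hK : k ≤ K) (hKn : K ≤ n)
    (hdn : d + d * K < n) (hn : 2 * d ≤ n)
    (hD : K ^ d * d ^ d * (2 ^ d * d.factorial) ≤ n) :
    ∃ σ : SearchStrategy n k, ∀ (τ : HideStrategy n d) (a : Allocation n d),
      k ^ d / Fintype.card (Allocation n d) ≤ winProbFrom σ τ a d [] := by
  have hn0 : 0 < n := by omega
  have hT : ∀ o : Shape n d, ∃ T : TreeData n d K, shape (T.leaf 0) = o ∧ ∀ χ ≠ 0,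
      o.occupied < occupied (T.leaf χ) ∨ (o.occupied = d ∧ occupied (T.leaf χ) = d) := by
    intro o
    obtain ⟨a, rfl⟩ := exists_shape_eq o
    obtain ⟨T, rfl, hT⟩ := exists_treeData (K := K) hdn a
    exact ⟨T, rfl, hT⟩
  choose T hT0 hT using hT
  obtain ⟨c, hc0, hc⟩ := exists_weights hn0 hn hD T hT0 hT
  choose σ hσ using fun p : Shape n d × Equiv.Perm (Fin n) =>
    ((T p.1).map p.2).exists_strategy hk hK hKn
  set W : Shape n d → Finset (Allocation n d) := fun o => Finset.univ.image (T o).leaf with hW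
  set A : ℝ := (Fintype.card (Allocation n d) : ℝ) with hA
  have : Nonempty (Fin n) := ⟨⟨0, hn0⟩⟩
  have hA0 : 0 < A := by
    have : Nonempty (Allocation n d) := ⟨Sym.replicate d ⟨0, hn0⟩⟩
    exact Nat.cast_pos.2 Fintype.card_pos
  have hK0 : (0 : ℝ) < K := hk.trans_le hK
  have hf0 : (0 : ℝ) < n.factorial := Nat.cast_pos.2 n.factorial_pos
  -- Each tree has `K ^ d` leaves, so the sum of the equations for `c` is its normalization.
  have hcsum : (∑ o, c o) * (K : ℝ) ^ d = A := by
    have hrow : ∀ o, ∑ o', (((W o).filter fun a => shape a = o').card : ℝ) = (K : ℝ) ^ d := by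
      intro o
      rw [← Nat.cast_sum, ← Finset.card_eq_sum_card_fiberwise (fun _ _ => Finset.mem_univ _),
        Finset.card_image_of_injective _ TreeData.leaf_injective]
      simp
    have hall : ∑ o', ((ofShape o' : Finset (Allocation n d)).card : ℝ) = A := by
      rw [hA, ← Finset.card_univ, Finset.card_eq_sum_card_fiberwise (f := shape)
        (t := (Finset.univ : Finset (Shape n d))) (fun _ _ => Finset.mem_univ _), Nat.cast_sum]
      rfl
    rw [← hall, ← Finset.sum_congr rfl fun o' _ => hc o', Finset.sum_comm, Finset.sum_mul]
    refine Finset.sum_congr rfl fun o _ => ?_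
    rw [← Finset.mul_sum, hrow]
  obtain ⟨σ', hσ'⟩ := exists_mixture (d := d)
    (fun p : Shape n d × Equiv.Perm (Fin n) => c p.1 * ((K : ℝ) ^ d / (A * n.factorial)))
    (fun p => mul_nonneg (hc0 _) (by positivity)) (by
      rw [Fintype.sum_prod_type]
      simp only [Finset.sum_const, Finset.card_univ, Fintype.card_perm, Fintype.card_fin,
        nsmul_eq_mul]
      rw [← Finset.mul_sum, ← Finset.sum_mul, ← mul_div_assoc, hcsum]
      field_simp) σ
  refine ⟨σ', fun τ a => ?_⟩
  rw [hσ', Fintype.sum_prod_type]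
  have hN0 : (0 : ℝ) < (ofShape (shape a)).card :=
    Nat.cast_pos.2 (Finset.card_pos.2 ⟨a, mem_ofShape.2 rfl⟩)
  -- The strategies for which `a` is a leaf of the tree already win often enough.
  have hwin : ∀ o π, (if π ∈ renamingsOnto (W o) a then (k / K) ^ d else 0) ≤
      winProbFrom (σ (o, π)) τ a d [] := by
    intro o π
    split_ifs with h
    · simp only [renamingsOnto, Finset.mem_filter, Finset.mem_univ, true_and, hW,
        Finset.mem_image] at h
      obtain ⟨_, ⟨χ, rfl⟩, rfl⟩ := h
      have := hσ (o, π) τ χ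
      rwa [TreeData.leaf_map] at this
    · exact winProbFrom_nonneg _ _ _ _ _
  have hcount : ∀ o, ((renamingsOnto (W o) a).card : ℝ) =
      n.factorial * ((W o).filter fun b => shape b = shape a).card / (ofShape (shape a)).card := by
    intro o
    rw [eq_div_iff hN0.ne', mul_comm]
    exact_mod_cast card_ofShape_mul_card_renamingsOnto (W o) a
  calc k ^ d / A
      = (K : ℝ) ^ d / (A * n.factorial) * (k / K) ^ d *
          (n.factorial / (ofShape (shape a)).card) *
            ∑ o, c o * (((W o).filter fun b => shape b = shape a).card : ℝ) := by
        rw [hc (shape a), div_pow]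
        field_simp
    _ = ∑ o, ∑ π, c o * ((K : ℝ) ^ d / (A * n.factorial)) *
          if π ∈ renamingsOnto (W o) a then (k / K) ^ d else 0 := by
        rw [Finset.mul_sum]
        refine Finset.sum_congr rfl fun o _ => ?_
        rw [← Finset.mul_sum, Finset.sum_ite_mem, Finset.univ_inter, Finset.sum_const,
          nsmul_eq_mul, hcount]
        ring
    _ ≤ _ := by
        refine Finset.sum_le_sum fun o _ => Finset.sum_le_sum fun π _ => ?_
        exact mul_le_mul_of_nonneg_left (hwin o π) (mul_nonneg (hc0 o) (by positivity))

end CachingGame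

theorem mainTheorem7 (d : ℕ) (k : ℝ) (hk : 0 < k) :
    ∃ N : ℕ, ∀ n : ℕ, N ≤ n →
      CachingGame.IsValue
        (fun (σ : CachingGame.SearchStrategy n k) (τ : CachingGame.HideStrategy n d) =>
          CachingGame.winProb σ τ)
        (k ^ d / ((n + d - 1).choose d : ℝ)) := by
  set K : ℕ := ⌈k⌉₊ with hKdef
  have hK0 : 0 < K := Nat.ceil_pos.2 hk
  have : NeZero K := ⟨hK0.ne'⟩
  refine ⟨K + d * K + 2 * d + 1 + K ^ d * d ^ d * (2 ^ d * d.factorial), fun n hN => ?_⟩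
  have hcard : Fintype.card (CachingGame.Allocation n d) = (n + d - 1).choose d := by
    have := Sym.card_sym_eq_choose (α := Fin n) d
    rwa [Fintype.card_fin] at this
  have : Nonempty (CachingGame.Allocation n d) := ⟨Sym.replicate d ⟨0, by omega⟩⟩
  rw [← hcard]
  constructor
  · obtain ⟨σ, hσ⟩ := CachingGame.exists_searchStrategy (n := n) (d := d) (K := K) hk
      (Nat.le_ceil k) (by omega) (by omega) (by omega) (by omega)
    refine ⟨σ, fun τ => ?_⟩
    calc k ^ d / (Fintype.card (CachingGame.Allocation n d) : ℝ)
        = ∑ a, τ.hide a * (k ^ d / (Fintype.card (CachingGame.Allocation n d) : ℝ)) := by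
          rw [← Finset.sum_mul, τ.hide_sum, one_mul]
      _ ≤ CachingGame.winProb σ τ := Finset.sum_le_sum fun a _ =>
          mul_le_mul_of_nonneg_left (hσ τ a) (τ.hide_nonneg a)
  · exact ⟨CachingGame.uniformHider n d, CachingGame.winProb_uniformHider_le⟩
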